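/- **Setting.** Let $E$ be a measurable space with countably generated $\sigma$-field, $\Theta$ an arbitrary parameter set, $(Q_\theta)_{\theta\in\Theta}$ Markov kernels on $E$, and $V:E\to[1,\infty)$ an unbounded measurable function. For a measure $\nu$ write $\nu(V)=\int V\,d\nu$. *Assumption (M).* For each $\theta$ there is a $Q_\theta$-invariant probability measure $\pi_\theta$ such that (VG1) $\sup_{\theta}\pi_\theta(V)<\infty$; (VG2) for every $\gamma\in(0,1]$ there are real numbers $\kappa_\gamma<1$ and $C_\gamma\ge 0$ such that $|Q_\theta^n f(x)-\pi_\theta(f)|\le C_\gamma\,\kappa_\gamma^n\,V(x)^\gamma$ for all $\theta\in\Theta$, $n\ge1$, $x\in E$ and all measurable $f:E\to\mathbb C$ with $|f|\le V^\gamma$. Let $\mathcal A\subset\mathbb R$ be an open interval, $\alpha_0:\Theta\to\mathcal A$ a function, and $\xi:\mathcal A\times E^2\to\mathbb R$ such that $\xi(\alpha,\cdot,\cdot)$ is measurable for every $\alpha$. Call $\xi$ *centered* if, for every $\theta$, $\xi(\alpha_0(\theta),x,y)$ is integrable with integral $0$ with respect to $\pi_\theta(dx)\,Q_\theta(x,dy)$.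 For an integer $m_0\ge1$, *condition $(D_{m_0})$* says that there are real constants $m>m_0$ and $C_\xi>0$ with $$|\xi(\alpha,x,y)|^m\le C_\xi\,(V(x)+V(y))\qquad\text{for all }\alpha\in\mathcal A,\ (x,y)\in E^2.$$ Let $\mu=(\mu_\theta)_{\theta\in\Theta}$ be initial probability distributions on $E$ with $\overline\mu(V):=\sup_\theta\mu_\theta(V)<\infty$, and let $\mathbb E_{\theta,\mu}$ be the expectation under which $(X_n)_{n\ge0}$ is a Markov chain with transition kernel $Q_\theta$ and initial distribution $\mu_\theta$. Put $S_n=\sum_{k=1}^n\xi(\alpha_0(\theta),X_{k-1},X_k)$. **Proposition.** Suppose that Assumption (M) holds and $\xi$ is centered. (i) If $\xi$ satisfies $(D_1)$, then $S_n$ is integrable, $\sup_{\theta\in\Theta}\sup_{n\ge1}|\mathbb E_{\theta,\mu}[S_n]|<\infty$, and in particular $\lim_n\mathbb E_{\theta,\mu}[S_n/n]=0$ for each $\theta$. (ii) If $\xi$ satisfies $(D_2)$, then $S_n^2$ is integrable and, for each $\theta\in\Theta$, the limit $$\sigma^2(\theta):=\lim_{n}\frac{\mathbb E_{\theta,\mu}[S_n^2]}{n}\in[0,\infty)$$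 exists and does not depend on $\mu$; the function $\sigma^2(\cdot)$ is bounded on $\Theta$; and there is a constant $C>0$ such that $$\Bigl|\sigma^2(\theta)-\frac{\mathbb E_{\theta,\mu}[S_n^2]}{n}\Bigr|\le\frac Cn\qquad\text{for all }\theta\in\Theta,\ n\ge1.$$ Once the model $(E,V,(Q_\theta)_{\theta\in\Theta})$ is fixed, $C$ can be chosen to depend only on the constant $C_\xi$ of $(D_2)$ and on $\overline\mu(V)$ (and not otherwise on $\xi$, $\alpha_0$, $m$ or $\mu$). -/

import Mathlib

open MeasureTheory ProbabilityTheory Filter Topology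
open scoped ENNReal

/-- `μ(V) = ∫ V dμ ∈ [0, ∞]`, for a nonnegative function `V`. -/
noncomputable def meanV {E : Type*} [MeasurableSpace E] (V : E → ℝ) (μ : Measure E) : ℝ≥0∞ :=
  ∫⁻ x, ENNReal.ofReal (V x) ∂μ

/-- Under the probability measure `P`, the process `X` is a time-homogeneous Markov chain with
transition kernel `κ` and initial distribution `μ`: `X 0` has law `μ`, and for each `n` the joint
law of `((X 0, …, X n), X (n + 1))` is obtained from the law of `(X 0, …, X n)` by drawing the next
state from `κ (X n)`. -/
structure IsMarkovChain {E Ω : Type*} [MeasurableSpace E] [MeasurableSpace Ω]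
    (P : Measure Ω) (X : ℕ → Ω → E) (κ : Kernel E E) (μ : Measure E) : Prop where
  isProbabilityMeasure : IsProbabilityMeasure P
  measurable : ∀ n, Measurable (X n)
  law_zero : P.map (X 0) = μ
  law_succ : ∀ n : ℕ,
    P.map (fun ω => ((fun i : Finset.Iic n => X i ω), X (n + 1) ω)) =
      (P.map (fun ω => fun i : Finset.Iic n => X i ω)) ⊗ₘ
        (κ.comap (fun x : Finset.Iic n → E => x ⟨n, Finset.mem_Iic.2 le_rfl⟩)
          (measurable_pi_apply _))

/-- Assumption (M): `V : E → [1, ∞)` is measurable and unbounded, each `Q θ` is a Markov kernel with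
an invariant probability measure `π θ`, and (VG1), (VG2) hold. -/
structure AssumptionM {E Θ : Type*} [MeasurableSpace E] (V : E → ℝ) (Q : Θ → Kernel E E)
    (π : Θ → Measure E) : Prop where
  measurable_V : Measurable V
  one_le_V : ∀ x, 1 ≤ V x
  unbounded_V : ¬ BddAbove (Set.range V)
  isMarkovKernel : ∀ θ, IsMarkovKernel (Q θ)
  isProbabilityMeasure : ∀ θ, IsProbabilityMeasure (π θ)
  invariant : ∀ θ, Kernel.Invariant (Q θ) (π θ)
  vg1 : ⨆ θ, meanV V (π θ) < ∞
  vg2 : ∀ γ : ℝ, 0 < γ → γ ≤ 1 → ∃ κ C : ℝ, κ < 1 ∧ 0 ≤ C ∧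
    ∀ (θ : Θ) (n : ℕ), 1 ≤ n → ∀ (x : E) (f : E → ℂ), Measurable f → (∀ y, ‖f y‖ ≤ V y ^ γ) →
      ‖(∫ y, f y ∂((Q θ ^ n) x)) - ∫ y, f y ∂(π θ)‖ ≤ C * κ ^ n * V x ^ γ

/-- The domination condition with exponent `m` and constant `K`. Condition `(D_{m₀})` asks that it
holds for some real `m > m₀` and some `K > 0`. -/
def Dominated {E A : Type*} (V : E → ℝ) (ξ : A → E → E → ℝ) (m K : ℝ) : Prop :=
  ∀ (α : A) (x y : E), |ξ α x y| ^ m ≤ K * (V x + V y)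

/-- Condition `(D_{m₀})`. -/
def ConditionD {E A : Type*} (V : E → ℝ) (ξ : A → E → E → ℝ) (m₀ : ℕ) : Prop :=
  ∃ m K : ℝ, (m₀ : ℝ) < m ∧ 0 < K ∧ Dominated V ξ m K

/-- `ξ` is centered: for each `θ`, `ξ (α₀ θ) (X₀, X₁)` is integrable with mean zero under the
stationary law `π θ (dx) Q θ (x, dy)` of `(X₀, X₁)`. -/
def IsCentered {E Θ A : Type*} [MeasurableSpace E] (Q : Θ → Kernel E E) (π : Θ → Measure E)
    (ξ : A → E → E → ℝ) (α₀ : Θ → A) : Prop :=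
  ∀ θ, Integrable (fun p : E × E => ξ (α₀ θ) p.1 p.2) (π θ ⊗ₘ Q θ) ∧
    ∫ p, ξ (α₀ θ) p.1 p.2 ∂(π θ ⊗ₘ Q θ) = 0

/-- `∑_{k=1}^n ξ(α, X_{k-1}, X_k)`. -/
def partialSum {E Ω A : Type*} (ξ : A → E → E → ℝ) (X : ℕ → Ω → E) (α : A) (n : ℕ) (ω : Ω) : ℝ :=
  ∑ k ∈ Finset.Icc 1 n, ξ α (X (k - 1) ω) (X k ω)

/-!
The proof compares the sums with a martingale. Let `h(x) = ∫ ξ(x, y) Q(x, dy)` be the drift of the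
increments; centering means `π(h) = 0`. If `ξ` is of the order of a weight `w` for which `Q` is
geometrically ergodic, then `|Qⁿ h| ≤ c ρⁿ w`. For `w = V` this already bounds the first moments,
since `E[S_n] = ∑_{k < n} E[h(X_k)]`.

For the second moments, the domination condition with an exponent above `2` bounds `|ξ(x, y)|` by
`L (√V(x) + √V(y))` with `L = max 1 C_ξ`, which does not depend on the exponent because `V ≥ 1`. The
weight is now `w = √V`. The Neumann series `u = ∑_n Qⁿ h` converges and solves the Poisson equation
`u - Q u = h`, with `|Q^l u| ≤ R ρ^l √V`. Hence `D(x, y) = ξ(x, y) + u(y) - u(x)` has zero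
conditional mean given `x`, and `W_n = S_n + u(X_n)` is a square integrable martingale with
increments `D(X_n, X_{n+1})` and with initial value `u(X₀)`. The variance is `σ² = ∫ D² d(π ⊗ Q)`,
which is nonnegative and independent of the initial law. Three facts give `E[S_n²] = n σ² + O(1)`.

* `E[W_{n+1}²] - E[W_n²] = E[d(X_n)]` with `d(x) = ∫ D(x, y)² Q(x, dy)` of order `V`, and this
  tends to `σ²` geometrically fast by ergodicity for the weight `V`
  (`SquareDominated.abs_integral_correctedSum_sq_sub_le`).
* `E[W_n u(X_n)]` is bounded in `n`. The Cauchy–Schwarz inequality would only give `O(√n)`; instead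
  `E[W_{n+1} Q^l u(X_{n+1})] = E[W_n Q^{l+1} u(X_n)] + O(ρ^l)` is iterated
  (`SquareDominated.abs_integral_correctedSum_mul_neumannTail_le`).
* `E[u(X_n)²]` is at most a constant times the initial mean of `V`.
-/

/-! ### Integrals of kernels and their iterates -/

lemma isMarkovKernel_pow {E : Type*} [MeasurableSpace E] (Q : Kernel E E) [IsMarkovKernel Q]
    (n : ℕ) : IsMarkovKernel (Q ^ n) := by
  induction n with
  | zero => exact inferInstanceAs (IsMarkovKernel Kernel.id)
  | succ n ih => rw [pow_succ]; exact inferInstanceAs (IsMarkovKernel ((Q ^ n) ∘ₖ Q))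

lemma integral_kernel_pow_zero {E : Type*} [MeasurableSpace E] (Q : Kernel E E) (x : E)
    {f : E → ℝ} (hf : Measurable f) : ∫ y, f y ∂(Q ^ 0) x = f x := by
  rw [pow_zero]
  change ∫ y, f y ∂(Kernel.id x) = f x
  rw [Kernel.id_apply, integral_dirac' _ _ hf.stronglyMeasurable]

lemma integral_kernel_pow_succ {E : Type*} [MeasurableSpace E] (Q : Kernel E E) (n : ℕ) (x : E)
    {f : E → ℝ} (hf : Integrable f ((Q ^ (n + 1)) x)) :
    ∫ y, f y ∂(Q ^ (n + 1)) x = ∫ y, ∫ z, f z ∂(Q ^ n) y ∂Q x := by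
  rw [pow_succ] at hf ⊢
  exact Kernel.integral_comp hf

lemma integral_bind_kernel {E : Type*} [MeasurableSpace E] (Q : Kernel E E) (μ : Measure E)
    {f : E → ℝ} (hf : Integrable f (μ.bind Q)) :
    ∫ y, f y ∂(μ.bind Q) = ∫ x, ∫ y, f y ∂Q x ∂μ := by
  rw [Measure.comp_eq_comp_const_apply] at hf ⊢
  rw [Kernel.integral_comp hf, Kernel.const_apply]

lemma abs_integral_le_of_abs_le {α : Type*} [MeasurableSpace α] {ν : Measure α} {f g : α → ℝ}
    (hg : Integrable g ν) (hfg : ∀ x, |f x| ≤ g x) : |∫ x, f x ∂ν| ≤ ∫ x, g x ∂ν :=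
  (Real.norm_eq_abs _).symm.trans_le <| norm_integral_le_of_norm_le hg (ae_of_all _ hfg)

lemma measurable_integral_kernel {E : Type*} [MeasurableSpace E] (Q : Kernel E E)
    [IsSFiniteKernel Q] {f : E → E → ℝ} (hf : Measurable fun p : E × E => f p.1 p.2) :
    Measurable fun x => ∫ y, f x y ∂Q x :=
  hf.stronglyMeasurable.integral_kernel_prod_right'.measurable

/-! ### Geometric ergodicity in a weighted supremum norm -/

/-- The iterates of `Q` converge to the probability measure `π` geometrically fast, uniformly over
the functions dominated by the weight `w ≥ 1`: the rate is `ρ`, and the constant `C` also bounds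
`π(w)`. The bound is asked for every `n`, `n = 0` included. -/
structure GeometricallyErgodic {E : Type*} [MeasurableSpace E] (Q : Kernel E E) (π : Measure E)
    (w : E → ℝ) (C ρ : ℝ) : Prop where
  measurable : Measurable w
  one_le : ∀ x, 1 ≤ w x
  one_le_const : 1 ≤ C
  rate_nonneg : 0 ≤ ρ
  rate_lt_one : ρ < 1
  integrable_invariant : Integrable w π
  integral_invariant_le : ∫ x, w x ∂π ≤ C
  integrable_pow : ∀ (n : ℕ) (x : E), Integrable w ((Q ^ n) x)
  abs_sub_le : ∀ (n : ℕ) (x : E) (f : E → ℝ), Measurable f → (∀ y, |f y| ≤ w y) →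
    |(∫ y, f y ∂(Q ^ n) x) - ∫ y, f y ∂π| ≤ C * ρ ^ n * w x

lemma integrable_of_abs_le_mul {E : Type*} [MeasurableSpace E] {ν : Measure E} {w : E → ℝ}
    (hν : Integrable w ν) {c : ℝ} {f : E → ℝ} (hf : Measurable f) (hfw : ∀ y, |f y| ≤ c * w y) :
    Integrable f ν :=
  (hν.const_mul c).mono' hf.aestronglyMeasurable (ae_of_all _ hfw)

/-- A bound, uniform in `N`, on the integrals of the truncations `min w N` makes `w` integrable. -/
lemma integrable_of_integral_min_le {E : Type*} [MeasurableSpace E] {ν : Measure E}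
    [IsFiniteMeasure ν] {w : E → ℝ} (hw : Measurable w) (hw0 : ∀ x, 0 ≤ w x) {B : ℝ}
    (hB : ∀ N : ℕ, ∫ x, min (w x) N ∂ν ≤ B) : Integrable w ν := by
  have hlim : Tendsto (fun N : ℕ => ∫⁻ x, ENNReal.ofReal (min (w x) N) ∂ν) atTop
      (𝓝 (∫⁻ x, ENNReal.ofReal (w x) ∂ν)) := by
    refine lintegral_tendsto_of_tendsto_of_monotone
      (fun N => (hw.min measurable_const).ennreal_ofReal.aemeasurable) ?_ ?_
    · refine ae_of_all _ fun x N N' h => ENNReal.ofReal_le_ofReal ?_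
      exact min_le_min le_rfl (by exact_mod_cast h)
    · refine ae_of_all _ fun x => ?_
      refine (tendsto_const_nhds).congr' ?_
      obtain ⟨N, hN⟩ := exists_nat_ge (w x)
      filter_upwards [eventually_ge_atTop N] with n hn
      rw [min_eq_left (hN.trans (by exact_mod_cast hn))]
  have hle : ∫⁻ x, ENNReal.ofReal (w x) ∂ν ≤ ENNReal.ofReal B := by
    refine le_of_tendsto' hlim fun N => ?_
    have h0 : ∀ x, 0 ≤ min (w x) (N : ℝ) := fun x => le_min (hw0 x) N.cast_nonneg
    have hint : Integrable (fun x => min (w x) (N : ℝ)) ν :=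
      Integrable.of_bound (hw.min measurable_const).aestronglyMeasurable (N : ℝ)
        (ae_of_all _ fun x => by rw [Real.norm_of_nonneg (h0 x)]; exact min_le_right _ _)
    rw [← ofReal_integral_eq_lintegral_ofReal hint (ae_of_all _ h0)]
    exact ENNReal.ofReal_le_ofReal (hB N)
  exact ⟨hw.aestronglyMeasurable,
    (hasFiniteIntegral_iff_ofReal (ae_of_all _ hw0)).2 (hle.trans_lt ENNReal.ofReal_lt_top)⟩

namespace GeometricallyErgodic

variable {E : Type*} [MeasurableSpace E] {Q : Kernel E E} {π : Measure E} {w : E → ℝ} {C ρ : ℝ}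

lemma mono (h : GeometricallyErgodic Q π w C ρ) {C' ρ' : ℝ} (hC : C ≤ C') (hρ : ρ ≤ ρ')
    (hρ' : ρ' < 1) : GeometricallyErgodic Q π w C' ρ' where
  measurable := h.measurable
  one_le := h.one_le
  one_le_const := h.one_le_const.trans hC
  rate_nonneg := h.rate_nonneg.trans hρ
  rate_lt_one := hρ'
  integrable_invariant := h.integrable_invariant
  integral_invariant_le := h.integral_invariant_le.trans hC
  integrable_pow := h.integrable_pow
  abs_sub_le n x f hf hfw := by
    refine (h.abs_sub_le n x f hf hfw).trans ?_
    have := h.one_le x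
    have := h.one_le_const
    have := h.rate_nonneg
    have : 0 ≤ C' := by linarith
    gcongr

lemma integrable_kernel (h : GeometricallyErgodic Q π w C ρ) (x : E) : Integrable w (Q x) := by
  simpa using h.integrable_pow 1 x

lemma abs_sub_le_of_abs_le_mul (h : GeometricallyErgodic Q π w C ρ) {c : ℝ} (hc : 0 ≤ c)
    {f : E → ℝ} (hf : Measurable f) (hfw : ∀ y, |f y| ≤ c * w y) (n : ℕ) (x : E) :
    |(∫ y, f y ∂(Q ^ n) x) - ∫ y, f y ∂π| ≤ c * C * ρ ^ n * w x := by
  rcases hc.eq_or_lt with rfl | hc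
  · have : f = fun _ => 0 := funext fun y => by simpa using hfw y
    simp [this]
  · have := h.abs_sub_le n x (fun y => c⁻¹ * f y) (hf.const_mul _) fun y => by
      rw [abs_mul, abs_of_pos (inv_pos.2 hc), inv_mul_le_iff₀ hc]
      exact hfw y
    rw [integral_const_mul, integral_const_mul, ← mul_sub, abs_mul, abs_of_pos (inv_pos.2 hc),
      inv_mul_le_iff₀ hc] at this
    linarith

lemma integral_pow_le (h : GeometricallyErgodic Q π w C ρ) (n : ℕ) (x : E) :
    ∫ y, w y ∂(Q ^ n) x ≤ 2 * C * w x := by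
  have h1 := (abs_le.1 (h.abs_sub_le n x w h.measurable fun y =>
    (abs_of_nonneg (zero_le_one.trans (h.one_le y))).le)).2
  have h2 : ρ ^ n ≤ 1 := pow_le_one₀ h.rate_nonneg h.rate_lt_one.le
  have h3 := h.integral_invariant_le
  have hC := h.one_le_const
  have hw := h.one_le x
  have h4 : C * ρ ^ n * w x ≤ C * 1 * w x := by gcongr
  nlinarith

lemma integral_kernel_le (h : GeometricallyErgodic Q π w C ρ) (x : E) :
    ∫ y, w y ∂Q x ≤ 2 * C * w x := by
  simpa using h.integral_pow_le 1 x

end GeometricallyErgodic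

/-- Assumption (M) in the form used below: for the weight `V ^ γ`, geometric ergodicity with
constants that do not depend on the parameter. -/
lemma AssumptionM.exists_geometricallyErgodic {E Θ : Type*} [MeasurableSpace E] {V : E → ℝ}
    {Q : Θ → Kernel E E} {π : Θ → Measure E} (hM : AssumptionM V Q π) {γ : ℝ} (hγ0 : 0 < γ)
    (hγ1 : γ ≤ 1) :
    ∃ C ρ : ℝ, ρ < 1 ∧ ∀ θ, GeometricallyErgodic (Q θ) (π θ) (fun x => V x ^ γ) C ρ := by
  obtain ⟨κ, C₀, hκ, hC₀, hbd⟩ := hM.vg2 γ hγ0 hγ1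
  set p : ℝ := (⨆ θ, meanV V (π θ)).toReal
  have hmeas : Measurable fun x => V x ^ γ := hM.measurable_V.pow_const γ
  have hone : ∀ x, 1 ≤ V x ^ γ := fun x => Real.one_le_rpow (hM.one_le_V x) hγ0.le
  have hle : ∀ x, V x ^ γ ≤ V x := fun x =>
    (Real.rpow_le_rpow_of_exponent_le (hM.one_le_V x) hγ1).trans_eq (Real.rpow_one _)
  have hp0 : 0 ≤ p := ENNReal.toReal_nonneg
  have hV0 : ∀ x, 0 ≤ V x := fun x => zero_le_one.trans (hM.one_le_V x)
  have hmean : ∀ θ, meanV V (π θ) < ∞ := fun θ => (le_iSup _ θ).trans_lt hM.vg1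
  have hVint : ∀ θ, Integrable V (π θ) := fun θ => ⟨hM.measurable_V.aestronglyMeasurable,
    (hasFiniteIntegral_iff_ofReal (ae_of_all _ hV0)).2 (hmean θ)⟩
  have hint : ∀ θ, Integrable (fun x => V x ^ γ) (π θ) := fun θ =>
    (hVint θ).mono' hmeas.aestronglyMeasurable (ae_of_all _ fun x => by
      rw [Real.norm_of_nonneg (zero_le_one.trans (hone x))]; exact hle x)
  have hpi : ∀ θ, ∫ x, V x ^ γ ∂(π θ) ≤ p := fun θ => by
    refine (integral_mono (hint θ) (hVint θ) hle).trans ?_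
    rw [integral_eq_lintegral_of_nonneg_ae (ae_of_all _ hV0)
      hM.measurable_V.aestronglyMeasurable]
    exact ENNReal.toReal_mono hM.vg1.ne (le_iSup (fun θ => meanV V (π θ)) θ)
  -- A negative `κ` is only possible with vanishing differences, so it may be replaced by `0`.
  have hbd' : ∀ (θ : Θ) (n : ℕ), 1 ≤ n → ∀ (x : E) (f : E → ℝ), Measurable f →
      (∀ y, |f y| ≤ V y ^ γ) →
      |(∫ y, f y ∂(Q θ ^ n) x) - ∫ y, f y ∂(π θ)| ≤ C₀ * max κ 0 ^ n * V x ^ γ := by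
    intro θ n hn x f hf hfV
    have h1 : ∀ k : ℕ, 1 ≤ k →
        |(∫ y, f y ∂(Q θ ^ k) x) - ∫ y, f y ∂(π θ)| ≤ C₀ * κ ^ k * V x ^ γ := fun k hk => by
      have := hbd θ k hk x (fun y => (f y : ℂ)) (Complex.measurable_ofReal.comp hf) fun y => by
        simpa using hfV y
      rwa [integral_complex_ofReal, integral_complex_ofReal, ← Complex.ofReal_sub,
        Complex.norm_real, Real.norm_eq_abs] at this
    rcases le_total 0 κ with h0 | h0
    · rw [max_eq_left h0]; exact h1 n hn
    · rcases h0.eq_or_lt with rfl | h0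
      · simpa using h1 n hn
      have h2 : 0 ≤ C₀ * κ ^ 1 * V x ^ γ := (abs_nonneg _).trans (h1 1 le_rfl)
      have hx := hone x
      have hC : C₀ = 0 := by
        by_contra hne
        have hpos : 0 < C₀ := lt_of_le_of_ne hC₀ (Ne.symm hne)
        have : C₀ * κ ^ 1 * V x ^ γ < 0 :=
          mul_neg_of_neg_of_pos (by rw [pow_one]; exact mul_neg_of_pos_of_neg hpos h0)
            (by linarith)
        linarith
      have := h1 n hn
      simpa [hC] using this
  -- The term `1 + p` covers `n = 0`, where `|f x - π(f)| ≤ w x + p`, and bounds `π(w) ≤ p`.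
  refine ⟨max C₀ (1 + p), max κ 0, max_lt hκ one_pos, fun θ => ?_⟩
  have := hM.isMarkovKernel θ
  have := hM.isProbabilityMeasure θ
  have hρ1 : max κ 0 ≤ 1 := (max_lt hκ one_pos).le
  refine ⟨hmeas, hone, ?_, le_max_right _ _, max_lt hκ one_pos, hint θ, ?_, fun n x => ?_,
    fun n x f hf hfV => ?_⟩
  · exact le_max_of_le_right (by linarith)
  · exact (hpi θ).trans (le_max_of_le_right (by linarith))
  · have := isMarkovKernel_pow (Q θ) n
    rcases Nat.eq_zero_or_pos n with rfl | hn
    · rw [pow_zero]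
      change Integrable _ (Kernel.id x)
      rw [Kernel.id_apply]
      exact integrable_dirac' hmeas.stronglyMeasurable (by simp)
    -- The Bochner integral of a non-integrable function is `0`, so the bound for `V ^ γ` itself
    -- says nothing yet about integrability; the bounds for its truncations do.
    refine integrable_of_integral_min_le hmeas (fun y => zero_le_one.trans (hone y))
      (B := C₀ * max κ 0 ^ n * V x ^ γ + p) fun N => ?_
    have h0 : ∀ y, 0 ≤ min (V y ^ γ) (N : ℝ) := fun y =>
      le_min (zero_le_one.trans (hone y)) N.cast_nonneg
    have h1 := (abs_le.1 (hbd' θ n hn x (fun y => min (V y ^ γ) N)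
      (hmeas.min measurable_const) fun y => by
        rw [abs_of_nonneg (h0 y)]; exact min_le_left _ _)).2
    have h2 : ∫ y, min (V y ^ γ) (N : ℝ) ∂(π θ) ≤ ∫ y, V y ^ γ ∂(π θ) :=
      integral_mono_of_nonneg (ae_of_all _ h0) (hint θ) (ae_of_all _ fun y => min_le_left _ _)
    linarith [hpi θ]
  · rcases Nat.eq_zero_or_pos n with rfl | hn
    · rw [integral_kernel_pow_zero _ _ hf, pow_zero, mul_one]
      have h1 : |∫ y, f y ∂(π θ)| ≤ p := (abs_integral_le_integral_abs).trans <|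
        (integral_mono_of_nonneg (ae_of_all _ fun y => abs_nonneg _) (hint θ)
          (ae_of_all _ hfV)).trans (hpi θ)
      have h2 : (1 + p) * V x ^ γ ≤ max C₀ (1 + p) * V x ^ γ :=
        mul_le_mul_of_nonneg_right (le_max_right _ _) (by linarith [hone x])
      have h3 := hone x
      have h4 := abs_sub (f x) (∫ y, f y ∂(π θ))
      nlinarith [hfV x]
    · refine (hbd' θ n hn x f hf hfV).trans ?_
      have := hone x
      have : (0 : ℝ) ≤ max κ 0 := le_max_right _ _
      gcongr
      exact le_max_left _ _

/-! ### The Poisson equation -/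

/-- The conditional mean `x ↦ ∫ ξ(x, y) Q(x, dy)` of an increment `ξ(X₀, X₁)` given `X₀ = x`. -/
noncomputable def drift {E : Type*} [MeasurableSpace E] (Q : Kernel E E) (ξ : E → E → ℝ) (x : E) :
    ℝ :=
  ∫ y, ξ x y ∂Q x

/-- The tail `∑_{n ≥ l} Qⁿ h` of the Neumann series. For `l = 0` it is the solution `u` of the
Poisson equation `u - Q u = h`, and in general it is `Q^l u`. -/
noncomputable def neumannTail {E : Type*} [MeasurableSpace E] (Q : Kernel E E) (h : E → ℝ) (l : ℕ)
    (x : E) : ℝ :=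
  ∑' n : ℕ, ∫ y, h y ∂(Q ^ (n + l)) x

namespace GeometricallyErgodic

variable {E : Type*} [MeasurableSpace E] {Q : Kernel E E} {π : Measure E} {w : E → ℝ} {C ρ : ℝ}

section Drift

variable {ξ : E → E → ℝ} {L : ℝ}

lemma measurable_drift [IsMarkovKernel Q] (hξ : Measurable fun p : E × E => ξ p.1 p.2) :
    Measurable (drift Q ξ) :=
  measurable_integral_kernel Q hξ

lemma integrable_increment [IsMarkovKernel Q] (hw : GeometricallyErgodic Q π w C ρ)
    (hξ : Measurable fun p : E × E => ξ p.1 p.2) (hξw : ∀ x y, |ξ x y| ≤ L * (w x + w y)) (x : E) :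
    Integrable (ξ x) (Q x) :=
  (((integrable_const (w x)).add (hw.integrable_kernel x)).const_mul L).mono'
    (hξ.comp measurable_prodMk_left).aestronglyMeasurable (ae_of_all _ (hξw x))

lemma abs_drift_le [IsMarkovKernel Q] (hw : GeometricallyErgodic Q π w C ρ) (hL : 0 ≤ L)
    (hξw : ∀ x y, |ξ x y| ≤ L * (w x + w y)) (x : E) :
    |drift Q ξ x| ≤ 3 * L * C * w x := by
  have hi : Integrable (fun y => L * (w x + w y)) (Q x) :=
    ((integrable_const (w x)).add (hw.integrable_kernel x)).const_mul L
  have h1 : |drift Q ξ x| ≤ ∫ y, L * (w x + w y) ∂Q x :=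
    abs_integral_le_of_abs_le hi (hξw x)
  rw [integral_const_mul, integral_add (integrable_const _) (hw.integrable_kernel x)] at h1
  simp only [integral_const, probReal_univ, smul_eq_mul, one_mul] at h1
  have h2 := hw.integral_kernel_le x
  have h3 := hw.one_le x
  have h4 := hw.one_le_const
  refine h1.trans ?_
  calc L * (w x + ∫ y, w y ∂Q x) ≤ L * (C * w x + 2 * C * w x) := by
        gcongr
        nlinarith
    _ = 3 * L * C * w x := by ring

end Drift

variable {h : E → ℝ} {c : ℝ}

lemma abs_integral_pow_le (hw : GeometricallyErgodic Q π w C ρ) (hc : 0 ≤ c) (hh : Measurable h)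
    (hhw : ∀ y, |h y| ≤ c * w y) (h0 : ∫ y, h y ∂π = 0) (n : ℕ) (x : E) :
    |∫ y, h y ∂(Q ^ n) x| ≤ c * C * ρ ^ n * w x := by
  simpa [h0] using hw.abs_sub_le_of_abs_le_mul hc hh hhw n x

lemma hasSum_bound (hw : GeometricallyErgodic Q π w C ρ) (l : ℕ) (a b : ℝ) :
    HasSum (fun n : ℕ => a * ρ ^ (n + l) * b) (a / (1 - ρ) * ρ ^ l * b) := by
  have := ((hasSum_geometric_of_lt_one hw.rate_nonneg hw.rate_lt_one).mul_left
    (a * ρ ^ l)).mul_right b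
  have he : a * ρ ^ l * (1 - ρ)⁻¹ * b = a / (1 - ρ) * ρ ^ l * b := by ring
  rw [he] at this
  refine this.congr_fun ?_
  intro n
  ring

lemma summable_integral_pow (hw : GeometricallyErgodic Q π w C ρ) (hc : 0 ≤ c) (hh : Measurable h)
    (hhw : ∀ y, |h y| ≤ c * w y) (h0 : ∫ y, h y ∂π = 0) (l : ℕ) (x : E) :
    Summable fun n : ℕ => ∫ y, h y ∂(Q ^ (n + l)) x :=
  Summable.of_norm_bounded (hw.hasSum_bound l (c * C) (w x)).summable
    fun n => hw.abs_integral_pow_le hc hh hhw h0 (n + l) x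

lemma abs_neumannTail_le (hw : GeometricallyErgodic Q π w C ρ) (hc : 0 ≤ c) (hh : Measurable h)
    (hhw : ∀ y, |h y| ≤ c * w y) (h0 : ∫ y, h y ∂π = 0) (l : ℕ) (x : E) :
    |neumannTail Q h l x| ≤ c * C / (1 - ρ) * ρ ^ l * w x := by
  rw [← Real.norm_eq_abs, neumannTail]
  exact tsum_of_norm_bounded (hw.hasSum_bound l (c * C) (w x))
    fun n => hw.abs_integral_pow_le hc hh hhw h0 (n + l) x

lemma measurable_neumannTail [IsMarkovKernel Q] (hw : GeometricallyErgodic Q π w C ρ) (hc : 0 ≤ c)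
    (hh : Measurable h) (hhw : ∀ y, |h y| ≤ c * w y) (h0 : ∫ y, h y ∂π = 0) (l : ℕ) :
    Measurable (neumannTail Q h l) := by
  refine measurable_of_tendsto_metrizable
    (f := fun (N : ℕ) x => ∑ n ∈ Finset.range N, ∫ y, h y ∂(Q ^ (n + l)) x) (fun N => ?_) ?_
  · refine Finset.measurable_sum _ fun n _ => ?_
    have := isMarkovKernel_pow Q (n + l)
    exact measurable_integral_kernel (Q ^ (n + l)) (hh.comp measurable_snd)
  · exact tendsto_pi_nhds.2 fun x =>
      (hw.summable_integral_pow hc hh hhw h0 l x).hasSum.tendsto_sum_nat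

lemma neumannTail_zero (hw : GeometricallyErgodic Q π w C ρ) (hc : 0 ≤ c) (hh : Measurable h)
    (hhw : ∀ y, |h y| ≤ c * w y) (h0 : ∫ y, h y ∂π = 0) (x : E) :
    neumannTail Q h 0 x = h x + neumannTail Q h 1 x := by
  have := (hw.summable_integral_pow hc hh hhw h0 0 x).tsum_eq_zero_add
  simp only [add_zero, integral_kernel_pow_zero Q x hh] at this
  simpa [neumannTail] using this

/-- `Q` shifts the tails of the Neumann series, since it may be applied term by term. -/
lemma integral_neumannTail [IsMarkovKernel Q] (hw : GeometricallyErgodic Q π w C ρ) (hc : 0 ≤ c)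
    (hh : Measurable h) (hhw : ∀ y, |h y| ≤ c * w y) (h0 : ∫ y, h y ∂π = 0) (l : ℕ) (x : E) :
    ∫ y, neumannTail Q h l y ∂Q x = neumannTail Q h (l + 1) x := by
  have hmeas : ∀ n, Measurable fun y => ∫ z, h z ∂(Q ^ (n + l)) y := fun n => by
    have := isMarkovKernel_pow Q (n + l)
    exact measurable_integral_kernel (Q ^ (n + l)) (hh.comp measurable_snd)
  have hbd : ∀ n y, |∫ z, h z ∂(Q ^ (n + l)) y| ≤ c * C * ρ ^ (n + l) * w y := fun n =>
    hw.abs_integral_pow_le hc hh hhw h0 (n + l)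
  have hint : ∀ n, Integrable (fun y => ∫ z, h z ∂(Q ^ (n + l)) y) (Q x) := fun n =>
    integrable_of_abs_le_mul (hw.integrable_kernel x) (hmeas n) (hbd n)
  unfold neumannTail
  rw [← integral_tsum_of_summable_integral_norm hint]
  · refine tsum_congr fun n => ?_
    rw [← add_assoc, integral_kernel_pow_succ]
    exact integrable_of_abs_le_mul (hw.integrable_pow _ x) hh hhw
  · refine Summable.of_norm_bounded
      (hw.hasSum_bound l (c * C) (∫ y, w y ∂Q x)).summable fun n => ?_
    rw [Real.norm_of_nonneg (integral_nonneg fun y => norm_nonneg _), ← integral_const_mul]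
    exact integral_mono (hint n).norm ((hw.integrable_kernel x).const_mul _) (hbd n)

end GeometricallyErgodic

lemma integral_drift_eq_zero {E : Type*} [MeasurableSpace E] {Q : Kernel E E} [IsMarkovKernel Q]
    {π : Measure E} [IsProbabilityMeasure π] {ξ : E → E → ℝ}
    (hint : Integrable (fun p : E × E => ξ p.1 p.2) (π ⊗ₘ Q))
    (h0 : ∫ p, ξ p.1 p.2 ∂(π ⊗ₘ Q) = 0) : ∫ x, drift Q ξ x ∂π = 0 := by
  rw [Measure.integral_compProd hint] at h0
  exact h0

/-! ### Expectations along the chain -/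

namespace IsMarkovChain

variable {E Ω : Type*} [MeasurableSpace E] [MeasurableSpace Ω] {P : Measure Ω} {X : ℕ → Ω → E}
  {Q : Kernel E E} {μ : Measure E}

lemma map_succ [IsMarkovKernel Q] (hX : IsMarkovChain P X Q μ) (n : ℕ) :
    P.map (X (n + 1)) = (P.map (X n)).bind Q := by
  have := hX.isProbabilityMeasure
  have hpath : Measurable fun ω => fun i : Finset.Iic n => X i ω :=
    measurable_pi_lambda _ fun i => hX.measurable i
  have h1 := congrArg Measure.snd (hX.law_succ n)
  rw [Measure.snd_compProd, Measure.snd, Measure.map_map measurable_snd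
    (hpath.prodMk (hX.measurable (n + 1)))] at h1
  have h2 : P.map (X n) = (P.map fun ω => fun i : Finset.Iic n => X i ω).map
      (fun x : Finset.Iic n → E => x ⟨n, Finset.mem_Iic.2 le_rfl⟩) := by
    rw [Measure.map_map (measurable_pi_apply _) hpath]
    rfl
  refine (Eq.trans rfl h1).trans ?_
  rw [h2, Measure.bind, Measure.bind, Measure.map_map Q.measurable (measurable_pi_apply _)]
  rfl

lemma map_eq_bind [IsMarkovKernel Q] (hX : IsMarkovChain P X Q μ) (n : ℕ) :
    P.map (X n) = μ.bind (Q ^ n) := by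
  induction n with
  | zero =>
    rw [hX.law_zero, pow_zero]
    exact Measure.id_comp.symm
  | succ n ih =>
    rw [hX.map_succ, ih, Measure.comp_assoc, pow_succ']
    rfl

/-- The Markov property, for a factor `G` depending on the past and an increment of the chain. -/
lemma integral_mul_increment [IsMarkovKernel Q] (hX : IsMarkovChain P X Q μ) {n : ℕ} {G : Ω → ℝ}
    (hG : Measurable[MeasurableSpace.comap (fun ω => fun i : Finset.Iic n => X i ω) inferInstance]
      G) {H : E → E → ℝ} (hH : Measurable fun p : E × E => H p.1 p.2)
    (hint : Integrable (fun ω => G ω * H (X n ω) (X (n + 1) ω)) P) :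
    ∫ ω, G ω * H (X n ω) (X (n + 1) ω) ∂P =
      ∫ ω, G ω * ∫ y, H (X n ω) y ∂Q (X n ω) ∂P := by
  have := hX.isProbabilityMeasure
  have hpath : Measurable fun ω => fun i : Finset.Iic n => X i ω :=
    measurable_pi_lambda _ fun i => hX.measurable i
  have hpair := hpath.prodMk (hX.measurable (n + 1))
  obtain ⟨g, hg, rfl⟩ := hG.exists_eq_measurable_comp
  set e : (Finset.Iic n → E) → E := fun x => x ⟨n, Finset.mem_Iic.2 le_rfl⟩
  have he : Measurable e := measurable_pi_apply _
  have hF : Measurable fun p : (Finset.Iic n → E) × E => g p.1 * H (e p.1) p.2 :=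
    (hg.comp measurable_fst).mul (hH.comp ((he.comp measurable_fst).prodMk measurable_snd))
  have hint' : Integrable (fun p : (Finset.Iic n → E) × E => g p.1 * H (e p.1) p.2)
      (P.map fun ω => ((fun i : Finset.Iic n => X i ω), X (n + 1) ω)) :=
    (integrable_map_measure hF.aestronglyMeasurable hpair.aemeasurable).2 hint
  have h1 := integral_map (μ := P) hpair.aemeasurable hF.aestronglyMeasurable
  rw [hX.law_succ n] at h1 hint'
  rw [Measure.integral_compProd hint'] at h1
  refine (Eq.trans rfl h1.symm).trans ?_
  have hK : Measurable fun x : Finset.Iic n → E => g x * ∫ y, H (e x) y ∂Q (e x) :=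
    hg.mul ((measurable_integral_kernel Q hH).comp he)
  simp only [integral_const_mul]
  exact integral_map hpath.aemeasurable hK.aestronglyMeasurable

lemma integral_increment [IsMarkovKernel Q] (hX : IsMarkovChain P X Q μ) {n : ℕ}
    {H : E → E → ℝ} (hH : Measurable fun p : E × E => H p.1 p.2)
    (hint : Integrable (fun ω => H (X n ω) (X (n + 1) ω)) P) :
    ∫ ω, H (X n ω) (X (n + 1) ω) ∂P = ∫ ω, drift Q H (X n ω) ∂P := by
  simpa [drift] using hX.integral_mul_increment (G := fun _ => 1) measurable_const hH
    (by simpa using hint)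

variable {π : Measure E} {w : E → ℝ} {C ρ : ℝ}

lemma integrable_weight [IsMarkovKernel Q] (hX : IsMarkovChain P X Q μ)
    (hw : GeometricallyErgodic Q π w C ρ) (hμ : Integrable w μ) (n : ℕ) :
    Integrable w (P.map (X n)) := by
  rw [hX.map_eq_bind, Measure.integrable_comp_iff hw.measurable.aestronglyMeasurable]
  refine ⟨ae_of_all _ (hw.integrable_pow n), integrable_of_abs_le_mul hμ (c := 2 * C) ?_ ?_⟩
  · have := isMarkovKernel_pow Q n
    exact measurable_integral_kernel (Q ^ n) (hw.measurable.norm.comp measurable_snd)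
  · intro x
    rw [abs_of_nonneg (integral_nonneg fun y => norm_nonneg _)]
    simpa [abs_of_nonneg (zero_le_one.trans (hw.one_le _))] using hw.integral_pow_le n x

lemma integral_eq_integral_pow [IsMarkovKernel Q] (hX : IsMarkovChain P X Q μ) {n : ℕ} {f : E → ℝ}
    (hf : Integrable f (P.map (X n))) :
    ∫ ω, f (X n ω) ∂P = ∫ x, ∫ y, f y ∂(Q ^ n) x ∂μ := by
  rw [← integral_map (hX.measurable n).aemeasurable hf.1]
  rw [hX.map_eq_bind] at hf ⊢
  exact integral_bind_kernel _ _ hf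

lemma isProbabilityMeasure_initial (hX : IsMarkovChain P X Q μ) : IsProbabilityMeasure μ := by
  have := hX.isProbabilityMeasure
  rw [← hX.law_zero]
  exact Measure.isProbabilityMeasure_map (hX.measurable 0).aemeasurable

lemma abs_integral_sub_le [IsMarkovKernel Q] (hX : IsMarkovChain P X Q μ)
    (hw : GeometricallyErgodic Q π w C ρ) (hμ : Integrable w μ) {c : ℝ} (hc : 0 ≤ c) {f : E → ℝ}
    (hf : Measurable f) (hfw : ∀ y, |f y| ≤ c * w y) (n : ℕ) :
    |(∫ ω, f (X n ω) ∂P) - ∫ y, f y ∂π| ≤ c * C * ρ ^ n * ∫ x, w x ∂μ := by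
  have := hX.isProbabilityMeasure_initial
  have := isMarkovKernel_pow Q n
  have hi := integrable_of_abs_le_mul (hX.integrable_weight hw hμ n) hf hfw
  have hb := hw.abs_sub_le_of_abs_le_mul hc hf hfw n
  have hm : Measurable fun x => ∫ y, f y ∂(Q ^ n) x :=
    measurable_integral_kernel (Q ^ n) (hf.comp measurable_snd)
  have hi2 : Integrable (fun x => (∫ y, f y ∂(Q ^ n) x) - ∫ y, f y ∂π) μ :=
    integrable_of_abs_le_mul hμ (hm.sub_const _) hb
  have hi3 : Integrable (fun x => ∫ y, f y ∂(Q ^ n) x) μ := by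
    refine (hi2.add (integrable_const (∫ y, f y ∂π))).congr (ae_of_all _ fun x => ?_)
    simp
  rw [hX.integral_eq_integral_pow hi]
  calc |(∫ x, ∫ y, f y ∂(Q ^ n) x ∂μ) - ∫ y, f y ∂π|
      = |∫ x, ((∫ y, f y ∂(Q ^ n) x) - ∫ y, f y ∂π) ∂μ| := by
        rw [integral_sub hi3 (integrable_const _)]; simp
    _ ≤ ∫ x, c * C * ρ ^ n * w x ∂μ :=
        abs_integral_le_of_abs_le (hμ.const_mul _) hb
    _ = c * C * ρ ^ n * ∫ x, w x ∂μ := integral_const_mul _ _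

lemma integral_weight_le [IsMarkovKernel Q] (hX : IsMarkovChain P X Q μ)
    (hw : GeometricallyErgodic Q π w C ρ) (hμ : Integrable w μ) (n : ℕ) :
    ∫ ω, w (X n ω) ∂P ≤ 2 * C * ∫ x, w x ∂μ := by
  have := isMarkovKernel_pow Q n
  rw [hX.integral_eq_integral_pow (hX.integrable_weight hw hμ n), ← integral_const_mul]
  refine integral_mono_of_nonneg (ae_of_all _ fun x => ?_) (hμ.const_mul _)
    (ae_of_all _ (hw.integral_pow_le n))
  exact integral_nonneg fun y => zero_le_one.trans (hw.one_le y)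

lemma integrable_comp_weight [IsMarkovKernel Q] (hX : IsMarkovChain P X Q μ)
    (hw : GeometricallyErgodic Q π w C ρ) (hμ : Integrable w μ) (n : ℕ) :
    Integrable (fun ω => w (X n ω)) P :=
  (hX.integrable_weight hw hμ n).comp_measurable (hX.measurable n)

lemma measurable_increment (hX : IsMarkovChain P X Q μ) {H : E → E → ℝ}
    (hH : Measurable fun p : E × E => H p.1 p.2) (n : ℕ) :
    Measurable fun ω => H (X n ω) (X (n + 1) ω) :=
  hH.comp ((hX.measurable n).prodMk (hX.measurable (n + 1)))

lemma integrable_increment [IsMarkovKernel Q] (hX : IsMarkovChain P X Q μ)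
    (hw : GeometricallyErgodic Q π w C ρ) (hμ : Integrable w μ) {H : E → E → ℝ}
    (hH : Measurable fun p : E × E => H p.1 p.2) {c : ℝ}
    (hHw : ∀ x y, |H x y| ≤ c * (w x + w y)) (n : ℕ) :
    Integrable (fun ω => H (X n ω) (X (n + 1) ω)) P :=
  (((hX.integrable_comp_weight hw hμ n).add (hX.integrable_comp_weight hw hμ (n + 1))).const_mul
    c).mono' (hX.measurable_increment hH n).aestronglyMeasurable (ae_of_all _ fun _ => hHw _ _)

lemma abs_integral_increment_le [IsMarkovKernel Q] (hX : IsMarkovChain P X Q μ)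
    (hw : GeometricallyErgodic Q π w C ρ) (hμ : Integrable w μ) {H : E → E → ℝ}
    {c : ℝ} (hc : 0 ≤ c) (hHw : ∀ x y, |H x y| ≤ c * (w x + w y)) (n : ℕ) :
    |∫ ω, H (X n ω) (X (n + 1) ω) ∂P| ≤ 4 * c * C * ∫ x, w x ∂μ := by
  have h1 := hX.integrable_comp_weight hw hμ n
  have h2 := hX.integrable_comp_weight hw hμ (n + 1)
  have h3 : |∫ ω, H (X n ω) (X (n + 1) ω) ∂P| ≤ ∫ ω, c * (w (X n ω) + w (X (n + 1) ω)) ∂P :=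
    abs_integral_le_of_abs_le ((h1.add h2).const_mul c) fun _ => hHw _ _
  rw [integral_const_mul, integral_add h1 h2] at h3
  calc _ ≤ _ := h3
    _ ≤ c * (2 * C * (∫ x, w x ∂μ) + 2 * C * ∫ x, w x ∂μ) := by
      gcongr <;> exact hX.integral_weight_le hw hμ _
    _ = 4 * c * C * ∫ x, w x ∂μ := by ring

end IsMarkovChain

/-! ### The martingale decomposition and the asymptotic variance -/

/-- The martingale increment `ξ(x, y) + u(y) - u(x)`, where `u` solves the Poisson equation for the
drift of `ξ`. -/
noncomputable def martingaleIncrement {E : Type*} [MeasurableSpace E] (Q : Kernel E E)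
    (ξ : E → E → ℝ) (x y : E) : ℝ :=
  ξ x y + neumannTail Q (drift Q ξ) 0 y - neumannTail Q (drift Q ξ) 0 x

/-- The second moment of the martingale increment in the stationary regime. It involves neither a
chain nor its initial law. -/
noncomputable def asymptoticVariance {E : Type*} [MeasurableSpace E] (Q : Kernel E E)
    (π : Measure E) (ξ : E → E → ℝ) : ℝ :=
  ∫ x, drift Q (fun x y => martingaleIncrement Q ξ x y ^ 2) x ∂π

lemma asymptoticVariance_nonneg {E : Type*} [MeasurableSpace E] (Q : Kernel E E) (π : Measure E)
    (ξ : E → E → ℝ) : 0 ≤ asymptoticVariance Q π ξ :=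
  integral_nonneg fun _ => integral_nonneg fun _ => sq_nonneg _

/-- The sum `∑_{k < n} ξ(X_k, X_{k+1})` corrected by `u(X_n)`: it is a martingale that starts at
`u(X₀)`. -/
noncomputable def correctedSum {E Ω : Type*} [MeasurableSpace E] (Q : Kernel E E)
    (ξ : E → E → ℝ) (X : ℕ → Ω → E) (n : ℕ) (ω : Ω) : ℝ :=
  (∑ k ∈ Finset.range n, ξ (X k ω) (X (k + 1) ω)) + neumannTail Q (drift Q ξ) 0 (X n ω)

lemma correctedSum_zero {E Ω : Type*} [MeasurableSpace E] (Q : Kernel E E)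
    (ξ : E → E → ℝ) (X : ℕ → Ω → E) (ω : Ω) :
    correctedSum Q ξ X 0 ω = neumannTail Q (drift Q ξ) 0 (X 0 ω) := by
  simp [correctedSum]

lemma correctedSum_succ {E Ω : Type*} [MeasurableSpace E] (Q : Kernel E E)
    (ξ : E → E → ℝ) (X : ℕ → Ω → E) (n : ℕ) (ω : Ω) :
    correctedSum Q ξ X (n + 1) ω =
      correctedSum Q ξ X n ω + martingaleIncrement Q ξ (X n ω) (X (n + 1) ω) := by
  simp only [correctedSum, martingaleIncrement, Finset.sum_range_succ]
  ring

/-- The setting of the second moment estimates: `Q` is geometrically ergodic for the weight `v` and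
for its square `V`, and `ξ` is centered and of order `v`. Increments of order `v` are then square
integrable along a chain whose initial law integrates `V`. -/
structure SquareDominated {E : Type*} [MeasurableSpace E] (Q : Kernel E E) (π : Measure E)
    (V v : E → ℝ) (C ρ : ℝ) (ξ : E → E → ℝ) (L : ℝ) : Prop where
  ergodic_sq : GeometricallyErgodic Q π V C ρ
  ergodic : GeometricallyErgodic Q π v C ρ
  sq_eq : ∀ x, v x ^ 2 = V x
  measurable : Measurable fun p : E × E => ξ p.1 p.2
  const_nonneg : 0 ≤ L
  abs_le : ∀ x y, |ξ x y| ≤ L * (v x + v y)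
  integral_drift : ∫ x, drift Q ξ x ∂π = 0

/-- A constant `R` such that `|Q^l u| ≤ R ρ^l v` for the solution `u` of the Poisson equation. -/
noncomputable def poissonConst (C ρ L : ℝ) : ℝ := 3 * L * C * C / (1 - ρ)

/-- The constant, relative to the initial mean of `V`, in the second moment estimate. -/
noncomputable def varianceConst (C ρ L : ℝ) : ℝ :=
  4 * C * poissonConst C ρ L ^ 2 + 6 * (L + poissonConst C ρ L) ^ 2 * C * C / (1 - ρ) +
    16 * (L + poissonConst C ρ L) * poissonConst C ρ L * C / (1 - ρ)

namespace SquareDominated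

variable {E : Type*} [MeasurableSpace E] {Q : Kernel E E} {π : Measure E} {V v : E → ℝ}
  {C ρ L : ℝ} {ξ : E → E → ℝ}

lemma poissonConst_nonneg (hs : SquareDominated Q π V v C ρ ξ L) : 0 ≤ poissonConst C ρ L := by
  have h1 := hs.ergodic.one_le_const
  have h2 := hs.ergodic.rate_lt_one
  have h3 := hs.const_nonneg
  exact div_nonneg (by positivity) (by linarith)

lemma drift_const_nonneg (hs : SquareDominated Q π V v C ρ ξ L) : 0 ≤ 3 * L * C := by
  have h1 := hs.ergodic.one_le_const
  have h3 := hs.const_nonneg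
  positivity

lemma sq_le (hs : SquareDominated Q π V v C ρ ξ L) {H : E → E → ℝ} {c : ℝ}
    (hH : ∀ x y, |H x y| ≤ c * (v x + v y)) (x y : E) :
    |H x y ^ 2| ≤ 2 * c ^ 2 * (V x + V y) := by
  rw [abs_of_nonneg (sq_nonneg _), ← sq_abs]
  have h1 : |H x y| ^ 2 ≤ (c * (v x + v y)) ^ 2 := by gcongr; exact hH x y
  rw [← hs.sq_eq x, ← hs.sq_eq y]
  nlinarith [mul_nonneg (sq_nonneg c) (sq_nonneg (v x - v y))]

lemma neumannTail_const_nonneg (hs : SquareDominated Q π V v C ρ ξ L) (l : ℕ) :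
    0 ≤ poissonConst C ρ L * ρ ^ l :=
  mul_nonneg hs.poissonConst_nonneg (pow_nonneg hs.ergodic.rate_nonneg l)

variable [IsMarkovKernel Q]

lemma abs_drift_le (hs : SquareDominated Q π V v C ρ ξ L) (x : E) :
    |drift Q ξ x| ≤ 3 * L * C * v x :=
  hs.ergodic.abs_drift_le hs.const_nonneg hs.abs_le x

lemma measurable_drift (hs : SquareDominated Q π V v C ρ ξ L) : Measurable (drift Q ξ) :=
  GeometricallyErgodic.measurable_drift hs.measurable

lemma measurable_neumannTail (hs : SquareDominated Q π V v C ρ ξ L) (l : ℕ) :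
    Measurable (neumannTail Q (drift Q ξ) l) :=
  hs.ergodic.measurable_neumannTail hs.drift_const_nonneg hs.measurable_drift hs.abs_drift_le
    hs.integral_drift l

lemma abs_neumannTail_le (hs : SquareDominated Q π V v C ρ ξ L) (l : ℕ) (x : E) :
    |neumannTail Q (drift Q ξ) l x| ≤ poissonConst C ρ L * ρ ^ l * v x :=
  hs.ergodic.abs_neumannTail_le hs.drift_const_nonneg hs.measurable_drift hs.abs_drift_le
    hs.integral_drift l x

lemma abs_neumannTail_zero_le (hs : SquareDominated Q π V v C ρ ξ L) (x : E) :
    |neumannTail Q (drift Q ξ) 0 x| ≤ poissonConst C ρ L * v x := by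
  simpa using hs.abs_neumannTail_le 0 x

lemma measurable_martingaleIncrement (hs : SquareDominated Q π V v C ρ ξ L) :
    Measurable fun p : E × E => martingaleIncrement Q ξ p.1 p.2 :=
  (hs.measurable.add ((hs.measurable_neumannTail 0).comp measurable_snd)).sub
    ((hs.measurable_neumannTail 0).comp measurable_fst)

lemma abs_martingaleIncrement_le (hs : SquareDominated Q π V v C ρ ξ L) (x y : E) :
    |martingaleIncrement Q ξ x y| ≤ (L + poissonConst C ρ L) * (v x + v y) := by
  have h1 := hs.abs_le x y
  have h2 := hs.abs_neumannTail_zero_le x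
  have h3 := hs.abs_neumannTail_zero_le y
  have h4 := abs_sub (ξ x y + neumannTail Q (drift Q ξ) 0 y) (neumannTail Q (drift Q ξ) 0 x)
  have h5 := abs_add_le (ξ x y) (neumannTail Q (drift Q ξ) 0 y)
  unfold martingaleIncrement
  linarith

lemma integrable_neumannTail (hs : SquareDominated Q π V v C ρ ξ L) (l : ℕ) (x : E) :
    Integrable (neumannTail Q (drift Q ξ) l) (Q x) :=
  integrable_of_abs_le_mul (hs.ergodic.integrable_kernel x) (hs.measurable_neumannTail l)
    (hs.abs_neumannTail_le l)

lemma integral_neumannTail (hs : SquareDominated Q π V v C ρ ξ L) (l : ℕ) (x : E) :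
    ∫ y, neumannTail Q (drift Q ξ) l y ∂Q x = neumannTail Q (drift Q ξ) (l + 1) x :=
  hs.ergodic.integral_neumannTail hs.drift_const_nonneg hs.measurable_drift hs.abs_drift_le
    hs.integral_drift l x

/-- The Poisson equation makes `martingaleIncrement` a martingale increment. -/
lemma integral_martingaleIncrement (hs : SquareDominated Q π V v C ρ ξ L) (x : E) :
    ∫ y, martingaleIncrement Q ξ x y ∂Q x = 0 := by
  have h1 := hs.ergodic.integrable_increment hs.measurable hs.abs_le x
  have h2 := hs.integrable_neumannTail 0 x
  have h3 := hs.ergodic.neumannTail_zero hs.drift_const_nonneg hs.measurable_drift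
    hs.abs_drift_le hs.integral_drift x
  have h4 : Integrable (fun y => ξ x y + neumannTail Q (drift Q ξ) 0 y) (Q x) := h1.add h2
  unfold martingaleIncrement
  rw [integral_sub h4 (integrable_const _), integral_add h1 h2,
    hs.integral_neumannTail 0 x, integral_const, probReal_univ, one_smul, h3]
  simp [drift]

lemma measurable_drift_sq (hs : SquareDominated Q π V v C ρ ξ L) :
    Measurable (drift Q fun x y => martingaleIncrement Q ξ x y ^ 2) :=
  GeometricallyErgodic.measurable_drift (hs.measurable_martingaleIncrement.pow_const 2)

lemma abs_drift_sq_le (hs : SquareDominated Q π V v C ρ ξ L) (x : E) :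
    |drift Q (fun x y => martingaleIncrement Q ξ x y ^ 2) x| ≤
      6 * (L + poissonConst C ρ L) ^ 2 * C * V x := by
  refine (hs.ergodic_sq.abs_drift_le (by positivity)
    (hs.sq_le hs.abs_martingaleIncrement_le) x).trans_eq ?_
  ring

lemma asymptoticVariance_le (hs : SquareDominated Q π V v C ρ ξ L) :
    asymptoticVariance Q π ξ ≤ 6 * (L + poissonConst C ρ L) ^ 2 * C * C := by
  have h1 := hs.ergodic.one_le_const
  refine (le_abs_self _).trans ((abs_integral_le_of_abs_le
    (hs.ergodic_sq.integrable_invariant.const_mul _) hs.abs_drift_sq_le).trans ?_)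
  rw [integral_const_mul]
  gcongr
  exact hs.ergodic_sq.integral_invariant_le

/-- The corrected sum up to time `n` is a function of the path up to time `n`. -/
lemma measurable_correctedSum {Ω : Type*} (hs : SquareDominated Q π V v C ρ ξ L) (X : ℕ → Ω → E)
    (n : ℕ) :
    Measurable[MeasurableSpace.comap (fun ω => fun i : Finset.Iic n => X i ω) inferInstance]
      (correctedSum Q ξ X n) := by
  let : MeasurableSpace Ω :=
    MeasurableSpace.comap (fun ω => fun i : Finset.Iic n => X i ω) inferInstance
  have hXm : ∀ k ≤ n, Measurable (X k) := fun k hk =>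
    (measurable_pi_apply (⟨k, Finset.mem_Iic.2 hk⟩ : Finset.Iic n)).comp
      (comap_measurable fun ω => fun i : Finset.Iic n => X i ω)
  refine Measurable.add (Finset.measurable_sum _ fun k hk => ?_)
    ((hs.measurable_neumannTail 0).comp (hXm n le_rfl))
  have hk' := Finset.mem_range.1 hk
  exact hs.measurable.comp ((hXm k hk'.le).prodMk (hXm (k + 1) hk'))

end SquareDominated

/-! ### Second moments of the sums -/

namespace SquareDominated

variable {E Ω : Type*} [MeasurableSpace E] [MeasurableSpace Ω] {P : Measure Ω} {X : ℕ → Ω → E}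
  {Q : Kernel E E} {μ π : Measure E} {V v : E → ℝ} {C ρ L : ℝ} {ξ : E → E → ℝ}
  [IsMarkovKernel Q]

lemma memLp_increment (hs : SquareDominated Q π V v C ρ ξ L) (hX : IsMarkovChain P X Q μ)
    (hμ : Integrable V μ) {H : E → E → ℝ} (hH : Measurable fun p : E × E => H p.1 p.2) {c : ℝ}
    (hHv : ∀ x y, |H x y| ≤ c * (v x + v y)) (n : ℕ) :
    MemLp (fun ω => H (X n ω) (X (n + 1) ω)) 2 P := by
  rw [memLp_two_iff_integrable_sq (hX.measurable_increment hH n).aestronglyMeasurable]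
  exact hX.integrable_increment hs.ergodic_sq hμ (hH.pow_const 2) (hs.sq_le hHv) n

lemma memLp_comp (hs : SquareDominated Q π V v C ρ ξ L) (hX : IsMarkovChain P X Q μ)
    (hμ : Integrable V μ) {f : E → ℝ} (hf : Measurable f) {c : ℝ} (hc : 0 ≤ c)
    (hfv : ∀ x, |f x| ≤ c * v x) (n : ℕ) : MemLp (fun ω => f (X n ω)) 2 P :=
  hs.memLp_increment hX hμ (H := fun x _ => f x) (hf.comp measurable_fst) (c := c)
    (fun x y => (hfv x).trans (mul_le_mul_of_nonneg_left
      (by linarith [hs.ergodic.one_le y]) hc)) n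

lemma memLp_sum (hs : SquareDominated Q π V v C ρ ξ L) (hX : IsMarkovChain P X Q μ)
    (hμ : Integrable V μ) (n : ℕ) :
    MemLp (fun ω => ∑ k ∈ Finset.range n, ξ (X k ω) (X (k + 1) ω)) 2 P :=
  memLp_finsetSum _ fun k _ => hs.memLp_increment hX hμ hs.measurable hs.abs_le k

lemma memLp_neumannTail (hs : SquareDominated Q π V v C ρ ξ L) (hX : IsMarkovChain P X Q μ)
    (hμ : Integrable V μ) (l n : ℕ) :
    MemLp (fun ω => neumannTail Q (drift Q ξ) l (X n ω)) 2 P :=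
  hs.memLp_comp hX hμ (hs.measurable_neumannTail l) (hs.neumannTail_const_nonneg l)
    (hs.abs_neumannTail_le l) n

lemma memLp_martingaleIncrement (hs : SquareDominated Q π V v C ρ ξ L)
    (hX : IsMarkovChain P X Q μ) (hμ : Integrable V μ) (n : ℕ) :
    MemLp (fun ω => martingaleIncrement Q ξ (X n ω) (X (n + 1) ω)) 2 P :=
  hs.memLp_increment hX hμ hs.measurable_martingaleIncrement hs.abs_martingaleIncrement_le n

lemma memLp_correctedSum (hs : SquareDominated Q π V v C ρ ξ L) (hX : IsMarkovChain P X Q μ)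
    (hμ : Integrable V μ) (n : ℕ) : MemLp (correctedSum Q ξ X n) 2 P :=
  (hs.memLp_sum hX hμ n).add (hs.memLp_neumannTail hX hμ 0 n)

/-- Martingale increments are orthogonal to the past, so the second moment of the corrected sum
grows by that of the increment. -/
lemma integral_correctedSum_sq_succ (hs : SquareDominated Q π V v C ρ ξ L)
    (hX : IsMarkovChain P X Q μ) (hμ : Integrable V μ) (n : ℕ) :
    ∫ ω, correctedSum Q ξ X (n + 1) ω ^ 2 ∂P = (∫ ω, correctedSum Q ξ X n ω ^ 2 ∂P) +
      ∫ ω, drift Q (fun x y => martingaleIncrement Q ξ x y ^ 2) (X n ω) ∂P := by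
  have hW := hs.memLp_correctedSum hX hμ n
  have hD := hs.memLp_martingaleIncrement hX hμ n
  have hWD : Integrable (fun ω => correctedSum Q ξ X n ω *
    martingaleIncrement Q ξ (X n ω) (X (n + 1) ω)) P := hW.integrable_mul hD
  have h1 := hX.integral_mul_increment (hs.measurable_correctedSum X n)
    hs.measurable_martingaleIncrement hWD
  simp only [hs.integral_martingaleIncrement, mul_zero, integral_zero] at h1
  have h2 := hX.integral_increment (n := n)
    (H := fun x y => martingaleIncrement Q ξ x y ^ 2) (hs.measurable_martingaleIncrement.pow_const 2)
    hD.integrable_sq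
  have h3 : ∀ ω, correctedSum Q ξ X (n + 1) ω ^ 2 = correctedSum Q ξ X n ω ^ 2 +
      2 * (correctedSum Q ξ X n ω * martingaleIncrement Q ξ (X n ω) (X (n + 1) ω)) +
      martingaleIncrement Q ξ (X n ω) (X (n + 1) ω) ^ 2 := fun ω => by
    rw [correctedSum_succ]; ring
  have h4 : Integrable (fun ω => correctedSum Q ξ X n ω ^ 2 + 2 * (correctedSum Q ξ X n ω *
      martingaleIncrement Q ξ (X n ω) (X (n + 1) ω))) P :=
    hW.integrable_sq.add (hWD.const_mul 2)
  simp only [h3]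
  rw [integral_add h4 hD.integrable_sq,
    integral_add hW.integrable_sq (hWD.const_mul 2), integral_const_mul, h1, h2]
  ring

lemma abs_integral_correctedSum_sq_sub_le (hs : SquareDominated Q π V v C ρ ξ L)
    (hX : IsMarkovChain P X Q μ) (hμ : Integrable V μ) (n : ℕ) :
    |(∫ ω, correctedSum Q ξ X n ω ^ 2 ∂P) - n * asymptoticVariance Q π ξ| ≤
      poissonConst C ρ L ^ 2 * (2 * C * ∫ x, V x ∂μ) +
      ∑ k ∈ Finset.range n,
        6 * (L + poissonConst C ρ L) ^ 2 * C * C * ρ ^ k * ∫ x, V x ∂μ := by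
  have hC := hs.ergodic.one_le_const
  induction n with
  | zero =>
    simp only [correctedSum_zero, Nat.cast_zero, zero_mul, sub_zero, Finset.range_zero,
      Finset.sum_empty, add_zero]
    refine (abs_integral_le_of_abs_le (g := fun ω => poissonConst C ρ L ^ 2 * V (X 0 ω))
      ((hX.integrable_comp_weight hs.ergodic_sq hμ 0).const_mul _) fun ω => ?_).trans ?_
    · rw [abs_of_nonneg (sq_nonneg _), ← sq_abs, ← hs.sq_eq, ← mul_pow]
      gcongr
      exact hs.abs_neumannTail_zero_le _
    · rw [integral_const_mul]
      gcongr
      exact hX.integral_weight_le hs.ergodic_sq hμ 0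
  | succ n ih =>
    have h1 := hX.abs_integral_sub_le hs.ergodic_sq hμ (by positivity) hs.measurable_drift_sq
      hs.abs_drift_sq_le n
    have h2 : (∫ ω, correctedSum Q ξ X (n + 1) ω ^ 2 ∂P)
        - (n + 1 : ℕ) * asymptoticVariance Q π ξ =
        ((∫ ω, correctedSum Q ξ X n ω ^ 2 ∂P) - n * asymptoticVariance Q π ξ) +
        ((∫ ω, drift Q (fun x y => martingaleIncrement Q ξ x y ^ 2) (X n ω) ∂P) -
          asymptoticVariance Q π ξ) := by
      rw [hs.integral_correctedSum_sq_succ hX hμ n]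
      push_cast
      ring
    rw [h2, Finset.sum_range_succ, ← add_assoc]
    exact (abs_add_le _ _).trans (add_le_add ih h1)

/-- The correlation of the corrected sum with `Q^l u(X_n)` is bounded uniformly in `n`: passing from
`n` to `n + 1` replaces `l` by `l + 1`, up to an error of order `ρ^l`, and these errors are
summable. -/
lemma abs_integral_correctedSum_mul_neumannTail_le (hs : SquareDominated Q π V v C ρ ξ L)
    (hX : IsMarkovChain P X Q μ) (hμ : Integrable V μ) (n l : ℕ) :
    |∫ ω, correctedSum Q ξ X n ω * neumannTail Q (drift Q ξ) l (X n ω) ∂P| ≤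
      8 * (L + poissonConst C ρ L) * poissonConst C ρ L * C * (∫ x, V x ∂μ) / (1 - ρ) * ρ ^ l := by
  have hC := hs.ergodic.one_le_const
  have hL := hs.const_nonneg
  have hR := hs.poissonConst_nonneg
  have hρ0 := hs.ergodic.rate_nonneg
  have hρ1 : 0 < 1 - ρ := by linarith [hs.ergodic.rate_lt_one]
  have hv0 : ∀ x, 0 ≤ v x := fun x => zero_le_one.trans (hs.ergodic.one_le x)
  have hM : 0 ≤ ∫ x, V x ∂μ :=
    integral_nonneg fun x => zero_le_one.trans (hs.ergodic_sq.one_le x)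
  set R := poissonConst C ρ L
  set A := 8 * (L + R) * R * C * ∫ x, V x ∂μ
  have hA : 0 ≤ A := by positivity
  induction n generalizing l with
  | zero =>
    simp only [correctedSum_zero]
    refine (abs_integral_le_of_abs_le (g := fun ω => R * R * ρ ^ l * V (X 0 ω))
      ((hX.integrable_comp_weight hs.ergodic_sq hμ 0).const_mul _) fun ω => ?_).trans ?_
    · rw [abs_mul, ← hs.sq_eq]
      have h1 := hs.abs_neumannTail_zero_le (X 0 ω)
      have h2 := hs.abs_neumannTail_le l (X 0 ω)
      calc _ ≤ (R * v (X 0 ω)) * (R * ρ ^ l * v (X 0 ω)) := by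
            gcongr
            exact mul_nonneg hR (hv0 _)
        _ = R * R * ρ ^ l * v (X 0 ω) ^ 2 := by ring
    · rw [integral_const_mul]
      have h1 := hX.integral_weight_le hs.ergodic_sq hμ 0
      calc _ ≤ R * R * ρ ^ l * (2 * C * ∫ x, V x ∂μ) := by gcongr
        _ = (2 * (R * R * C * ∫ x, V x ∂μ)) * ρ ^ l := by ring
        _ ≤ A / (1 - ρ) * ρ ^ l := by
          gcongr
          rw [le_div_iff₀ hρ1]
          have h3 : 0 ≤ R * R * C * ∫ x, V x ∂μ := by positivity
          have h4 : 0 ≤ L * R * C * ∫ x, V x ∂μ := by positivity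
          have h5 : A = 8 * (L * R * C * ∫ x, V x ∂μ) + 8 * (R * R * C * ∫ x, V x ∂μ) := by
            simp only [A]; ring
          nlinarith
  | succ n ih =>
    have hW := hs.memLp_correctedSum hX hμ n
    have hD := hs.memLp_martingaleIncrement hX hμ n
    have hU := hs.memLp_neumannTail hX hμ l (n + 1)
    have hWU : Integrable (fun ω => correctedSum Q ξ X n ω *
      neumannTail Q (drift Q ξ) l (X (n + 1) ω)) P := hW.integrable_mul hU
    have hDU : Integrable (fun ω => martingaleIncrement Q ξ (X n ω) (X (n + 1) ω) *
      neumannTail Q (drift Q ξ) l (X (n + 1) ω)) P := hD.integrable_mul hU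
    have h1 := hX.integral_mul_increment (hs.measurable_correctedSum X n)
      (H := fun _ y => neumannTail Q (drift Q ξ) l y)
      ((hs.measurable_neumannTail l).comp measurable_snd) hWU
    simp only [hs.integral_neumannTail] at h1
    have h2 := hX.abs_integral_increment_le hs.ergodic_sq hμ (c := 2 * (L + R) * (R * ρ ^ l))
      (H := fun x y => martingaleIncrement Q ξ x y * neumannTail Q (drift Q ξ) l y)
      (by positivity) (fun x y => by
        rw [abs_mul]
        have h3 := hs.abs_martingaleIncrement_le x y
        have h4 := hs.abs_neumannTail_le l y
        calc _ ≤ ((L + R) * (v x + v y)) * (R * ρ ^ l * v y) := by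
              gcongr
              exact mul_nonneg (by positivity) (add_nonneg (hv0 x) (hv0 y))
          _ = (L + R) * (R * ρ ^ l) * ((v x + v y) * v y) := by ring
          _ ≤ (L + R) * (R * ρ ^ l) * (2 * (V x + V y)) := by
              refine mul_le_mul_of_nonneg_left ?_ (by positivity)
              rw [← hs.sq_eq, ← hs.sq_eq]
              nlinarith [sq_nonneg (v x - v y), sq_nonneg (v x), sq_nonneg (v y)]
          _ = _ := by ring) n
    simp only [correctedSum_succ, add_mul]
    rw [integral_add hWU hDU, h1]
    calc _ ≤ A / (1 - ρ) * ρ ^ (l + 1) +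
          4 * (2 * (L + R) * (R * ρ ^ l)) * C * ∫ x, V x ∂μ :=
          (abs_add_le _ _).trans (add_le_add (ih (l + 1)) h2)
      _ = A / (1 - ρ) * ρ ^ l := by
        simp only [A]
        field_simp
        ring

/-- The sum differs from the corrected sum by `u(X_n)`, whose correlation with the latter and whose
second moment are bounded. -/
lemma abs_integral_sum_sq_sub_le (hs : SquareDominated Q π V v C ρ ξ L)
    (hX : IsMarkovChain P X Q μ) (hμ : Integrable V μ) (n : ℕ) :
    |(∫ ω, (∑ k ∈ Finset.range n, ξ (X k ω) (X (k + 1) ω)) ^ 2 ∂P) -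
        n * asymptoticVariance Q π ξ| ≤ varianceConst C ρ L * ∫ x, V x ∂μ := by
  have hC := hs.ergodic.one_le_const
  have hL := hs.const_nonneg
  have hR := hs.poissonConst_nonneg
  have hρ1 : 0 < 1 - ρ := by linarith [hs.ergodic.rate_lt_one]
  have hM : 0 ≤ ∫ x, V x ∂μ :=
    integral_nonneg fun x => zero_le_one.trans (hs.ergodic_sq.one_le x)
  have hW := hs.memLp_correctedSum hX hμ n
  have hU := hs.memLp_neumannTail hX hμ 0 n
  have hWU : Integrable (fun ω => correctedSum Q ξ X n ω *
    neumannTail Q (drift Q ξ) 0 (X n ω)) P := hW.integrable_mul hU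
  have h1 := hs.abs_integral_correctedSum_sq_sub_le hX hμ n
  have h2 := hs.abs_integral_correctedSum_mul_neumannTail_le hX hμ n 0
  have h3 : |∫ ω, neumannTail Q (drift Q ξ) 0 (X n ω) ^ 2 ∂P| ≤
      poissonConst C ρ L ^ 2 * (2 * C * ∫ x, V x ∂μ) := by
    refine (abs_integral_le_of_abs_le (g := fun ω => poissonConst C ρ L ^ 2 * V (X n ω))
      ((hX.integrable_comp_weight hs.ergodic_sq hμ n).const_mul _) fun ω => ?_).trans ?_
    · rw [abs_of_nonneg (sq_nonneg _), ← sq_abs, ← hs.sq_eq, ← mul_pow]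
      gcongr
      exact hs.abs_neumannTail_zero_le _
    · rw [integral_const_mul]
      gcongr
      exact hX.integral_weight_le hs.ergodic_sq hμ n
  have h4 : ∑ k ∈ Finset.range n,
      6 * (L + poissonConst C ρ L) ^ 2 * C * C * ρ ^ k * ∫ x, V x ∂μ ≤
      6 * (L + poissonConst C ρ L) ^ 2 * C * C / (1 - ρ) * ∫ x, V x ∂μ := by
    have := hs.ergodic.hasSum_bound 0 (6 * (L + poissonConst C ρ L) ^ 2 * C * C) (∫ x, V x ∂μ)
    simp only [add_zero, pow_zero, mul_one] at this
    have hρ0 := hs.ergodic.rate_nonneg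
    exact sum_le_hasSum _ (fun k _ => by positivity) this
  have h5 : ∀ ω, (∑ k ∈ Finset.range n, ξ (X k ω) (X (k + 1) ω)) ^ 2 =
      correctedSum Q ξ X n ω ^ 2 -
        2 * (correctedSum Q ξ X n ω * neumannTail Q (drift Q ξ) 0 (X n ω)) +
        neumannTail Q (drift Q ξ) 0 (X n ω) ^ 2 := fun ω => by
    simp only [correctedSum]; ring
  have h7 : Integrable (fun ω => correctedSum Q ξ X n ω ^ 2 -
      2 * (correctedSum Q ξ X n ω * neumannTail Q (drift Q ξ) 0 (X n ω))) P :=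
    hW.integrable_sq.sub (hWU.const_mul 2)
  simp only [h5]
  rw [integral_add h7 hU.integrable_sq,
    integral_sub hW.integrable_sq (hWU.const_mul 2), integral_const_mul]
  have h6 : varianceConst C ρ L * ∫ x, V x ∂μ =
      2 * (poissonConst C ρ L ^ 2 * (2 * C * ∫ x, V x ∂μ)) +
      6 * (L + poissonConst C ρ L) ^ 2 * C * C / (1 - ρ) * (∫ x, V x ∂μ) +
      2 * (8 * (L + poissonConst C ρ L) * poissonConst C ρ L * C * (∫ x, V x ∂μ) / (1 - ρ)
        * ρ ^ 0) := by
    unfold varianceConst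
    ring
  rw [h6]
  rw [_root_.abs_le] at h1 h2 h3 ⊢
  constructor <;> linarith [h1.1, h1.2, h2.1, h2.2, h3.1, h3.2]

end SquareDominated

/-! ### First moments of the sums -/

lemma IsMarkovChain.abs_integral_sum_le {E Ω : Type*} [MeasurableSpace E] [MeasurableSpace Ω]
    {P : Measure Ω} {X : ℕ → Ω → E} {Q : Kernel E E} {μ π : Measure E} {w : E → ℝ} {C ρ L : ℝ}
    {ξ : E → E → ℝ} [IsMarkovKernel Q] (hX : IsMarkovChain P X Q μ)
    (hw : GeometricallyErgodic Q π w C ρ) (hμ : Integrable w μ)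
    (hξ : Measurable fun p : E × E => ξ p.1 p.2) (hL : 0 ≤ L)
    (hξw : ∀ x y, |ξ x y| ≤ L * (w x + w y)) (h0 : ∫ x, drift Q ξ x ∂π = 0) (n : ℕ) :
    |∫ ω, ∑ k ∈ Finset.range n, ξ (X k ω) (X (k + 1) ω) ∂P| ≤
      poissonConst C ρ L * ∫ x, w x ∂μ := by
  have hC := hw.one_le_const
  have hρ0 := hw.rate_nonneg
  have hM : 0 ≤ ∫ x, w x ∂μ := integral_nonneg fun x => zero_le_one.trans (hw.one_le x)
  rw [integral_finsetSum _ fun k _ => hX.integrable_increment hw hμ hξ hξw k]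
  calc |∑ k ∈ Finset.range n, ∫ ω, ξ (X k ω) (X (k + 1) ω) ∂P|
      ≤ ∑ k ∈ Finset.range n, |∫ ω, ξ (X k ω) (X (k + 1) ω) ∂P| := Finset.abs_sum_le_sum_abs _ _
    _ ≤ ∑ k ∈ Finset.range n, 3 * L * C * C * ρ ^ k * ∫ x, w x ∂μ := by
        refine Finset.sum_le_sum fun k _ => ?_
        rw [hX.integral_increment hξ (hX.integrable_increment hw hμ hξ hξw k)]
        simpa [h0] using hX.abs_integral_sub_le hw hμ (by positivity)
          (GeometricallyErgodic.measurable_drift hξ) (hw.abs_drift_le hL hξw) k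
    _ ≤ poissonConst C ρ L * ∫ x, w x ∂μ := by
        have := hw.hasSum_bound 0 (3 * L * C * C) (∫ x, w x ∂μ)
        simp only [add_zero, pow_zero, mul_one] at this
        exact sum_le_hasSum _ (fun k _ => by positivity) this

/-! ### From assumption (M) and the domination conditions to the moment estimates -/

lemma partialSum_eq_sum_range {E Ω A : Type*} (ξ : A → E → E → ℝ) (X : ℕ → Ω → E) (α : A) (n : ℕ)
    (ω : Ω) : partialSum ξ X α n ω = ∑ k ∈ Finset.range n, ξ α (X k ω) (X (k + 1) ω) := by
  unfold partialSum
  induction n with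
  | zero => simp
  | succ n ih => rw [Finset.sum_Icc_succ_top (by omega), ih, Finset.sum_range_succ]; simp

/-- Since `V ≥ 1`, domination with exponent `m` gives domination with every smaller integer
exponent, and the new constant does not depend on `m`. -/
lemma Dominated.abs_pow_le {E A : Type*} {V : E → ℝ} {ξ : A → E → E → ℝ} {m K : ℝ}
    (h : Dominated V ξ m K) (hV : ∀ x, 1 ≤ V x) {k : ℕ} (hk : (k : ℝ) ≤ m) (α : A) (x y : E) :
    |ξ α x y| ^ k ≤ max 1 K * (V x + V y) := by
  have hx := hV x
  have hy := hV y
  rcases le_total |ξ α x y| 1 with h1 | h1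
  · calc |ξ α x y| ^ k ≤ 1 := pow_le_one₀ (abs_nonneg _) h1
      _ ≤ 1 * (V x + V y) := by linarith
      _ ≤ max 1 K * (V x + V y) := mul_le_mul_of_nonneg_right (le_max_left _ _) (by linarith)
  · calc |ξ α x y| ^ k = |ξ α x y| ^ (k : ℝ) := (Real.rpow_natCast _ _).symm
      _ ≤ |ξ α x y| ^ m := Real.rpow_le_rpow_of_exponent_le h1 hk
      _ ≤ K * (V x + V y) := h α x y
      _ ≤ max 1 K * (V x + V y) := mul_le_mul_of_nonneg_right (le_max_right _ _) (by linarith)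

lemma integrable_of_meanV_lt_top {E : Type*} [MeasurableSpace E] {V : E → ℝ} (hVm : Measurable V)
    (hV : ∀ x, 1 ≤ V x) {μ : Measure E} (h : meanV V μ < ∞) : Integrable V μ :=
  ⟨hVm.aestronglyMeasurable, (hasFiniteIntegral_iff_ofReal
    (ae_of_all _ fun x => zero_le_one.trans (hV x))).2 h⟩

lemma integral_le_of_meanV_le {E : Type*} [MeasurableSpace E] {V : E → ℝ} (hVm : Measurable V)
    (hV : ∀ x, 1 ≤ V x) {μ : Measure E} {M : ℝ} (h : meanV V μ ≤ ENNReal.ofReal M) :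
    ∫ x, V x ∂μ ≤ |M| := by
  rw [integral_eq_lintegral_of_nonneg_ae (ae_of_all _ fun x => zero_le_one.trans (hV x))
    hVm.aestronglyMeasurable]
  refine ENNReal.toReal_le_of_le_ofReal (abs_nonneg M) (h.trans ?_)
  exact ENNReal.ofReal_le_ofReal (le_abs_self M)

lemma IsCentered.integral_drift {E Θ A : Type*} [MeasurableSpace E] {V : E → ℝ}
    {Q : Θ → Kernel E E} {π : Θ → Measure E} (hM : AssumptionM V Q π) {ξ : A → E → E → ℝ}
    {α₀ : Θ → A} (hc : IsCentered Q π ξ α₀) (θ : Θ) :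
    ∫ x, drift (Q θ) (ξ (α₀ θ)) x ∂(π θ) = 0 := by
  have := hM.isMarkovKernel θ
  have := hM.isProbabilityMeasure θ
  exact integral_drift_eq_zero (hc θ).1 (hc θ).2

/-- Geometric ergodicity for `V` and for `√V`, with common constants for all parameters. -/
lemma AssumptionM.exists_geometricallyErgodic_sqrt {E Θ : Type*} [MeasurableSpace E] {V : E → ℝ}
    {Q : Θ → Kernel E E} {π : Θ → Measure E} (hM : AssumptionM V Q π) :
    ∃ C ρ : ℝ, ∀ θ, GeometricallyErgodic (Q θ) (π θ) V C ρ ∧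
      GeometricallyErgodic (Q θ) (π θ) (fun x => √(V x)) C ρ := by
  obtain ⟨C₁, ρ₁, hρ₁, h₁⟩ := hM.exists_geometricallyErgodic one_pos le_rfl
  obtain ⟨C₂, ρ₂, hρ₂, h₂⟩ := hM.exists_geometricallyErgodic (γ := 1 / 2) (by norm_num)
    (by norm_num)
  simp only [Real.rpow_one] at h₁
  simp only [← Real.sqrt_eq_rpow] at h₂
  exact ⟨max C₁ C₂, max ρ₁ ρ₂, fun θ =>
    ⟨(h₁ θ).mono (le_max_left _ _) (le_max_left _ _) (max_lt hρ₁ hρ₂),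
      (h₂ θ).mono (le_max_right _ _) (le_max_right _ _) (max_lt hρ₁ hρ₂)⟩⟩

lemma SquareDominated.of_dominated {E Θ A : Type*} [MeasurableSpace E] {V : E → ℝ}
    {Q : Θ → Kernel E E} {π : Θ → Measure E} (hM : AssumptionM V Q π) {C ρ : ℝ}
    (hC : ∀ θ, GeometricallyErgodic (Q θ) (π θ) V C ρ ∧
      GeometricallyErgodic (Q θ) (π θ) (fun x => √(V x)) C ρ)
    {ξ : A → E → E → ℝ} {α₀ : Θ → A} (hξ : ∀ α, Measurable fun p : E × E => ξ α p.1 p.2)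
    (hc : IsCentered Q π ξ α₀) {m K : ℝ} (hm : 2 < m) (hK : Dominated V ξ m K) (θ : Θ) :
    SquareDominated (Q θ) (π θ) V (fun x => √(V x)) C ρ (ξ (α₀ θ)) (max 1 K) where
  ergodic_sq := (hC θ).1
  ergodic := (hC θ).2
  sq_eq x := Real.sq_sqrt (zero_le_one.trans (hM.one_le_V x))
  measurable := hξ _
  const_nonneg := zero_le_one.trans (le_max_left _ _)
  abs_le x y := by
    have h1 := hK.abs_pow_le hM.one_le_V (k := 2) (by exact_mod_cast hm.le) (α₀ θ) x y
    have hL : 1 ≤ max 1 K := le_max_left _ _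
    refine abs_le_of_sq_le_sq ?_ (by positivity)
    rw [← sq_abs]
    refine h1.trans ?_
    have hx := Real.sq_sqrt (zero_le_one.trans (hM.one_le_V x))
    have hy := Real.sq_sqrt (zero_le_one.trans (hM.one_le_V y))
    have h2 : V x + V y ≤ (√(V x) + √(V y)) ^ 2 := by
      have := mul_nonneg (Real.sqrt_nonneg (V x)) (Real.sqrt_nonneg (V y))
      nlinarith
    rw [mul_pow]
    have h3 : 0 ≤ V x + V y := by linarith [hM.one_le_V x, hM.one_le_V y]
    exact mul_le_mul (by nlinarith) h2 h3 (by positivity)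
  integral_drift := hc.integral_drift hM θ

lemma tendsto_of_abs_sub_le_div {u : ℕ → ℝ} {a B : ℝ} (h : ∀ n : ℕ, 1 ≤ n → |a - u n| ≤ B / n) :
    Tendsto u atTop (𝓝 a) := by
  refine tendsto_iff_norm_sub_tendsto_zero.2 (squeeze_zero' (Eventually.of_forall fun n =>
    norm_nonneg _) ?_ (tendsto_const_div_atTop_nhds_zero_nat B))
  filter_upwards [eventually_ge_atTop 1] with n hn
  rw [Real.norm_eq_abs, abs_sub_comm]
  exact h n hn

theorem proposition3 {E : Type*} [MeasurableSpace E] [MeasurableSpace.CountablyGenerated E]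
    {Θ : Type*} (V : E → ℝ) (Q : Θ → Kernel E E) (π : Θ → Measure E) (hM : AssumptionM V Q π) :
    -- first part: under `(D_1)`
    (∀ (A : Set ℝ), IsOpen A → A.OrdConnected →
      ∀ (ξ : A → E → E → ℝ) (α₀ : Θ → A),
        (∀ α, Measurable (fun p : E × E => ξ α p.1 p.2)) →
        IsCentered Q π ξ α₀ → ConditionD V ξ 1 →
        ∀ {Ω : Type*} [MeasurableSpace Ω] (P : Θ → Measure Ω) (X : ℕ → Ω → E) (μ : Θ → Measure E),
          (∀ θ, IsMarkovChain (P θ) X (Q θ) (μ θ)) → ⨆ θ, meanV V (μ θ) < ∞ →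
          (∀ θ n, Integrable (partialSum ξ X (α₀ θ) n) (P θ)) ∧
          (∃ B : ℝ, ∀ θ, ∀ n : ℕ, 1 ≤ n → |∫ ω, partialSum ξ X (α₀ θ) n ω ∂(P θ)| ≤ B) ∧
          (∀ θ, Tendsto (fun n : ℕ => ∫ ω, partialSum ξ X (α₀ θ) n ω / n ∂(P θ)) atTop (𝓝 0))) ∧
    -- second part: under `(D_2)`, with `C` a function of `C_ξ` and of a bound `M` of `sup_θ μ_θ(V)`
    (∃ C : ℝ → ℝ → ℝ, (∀ K M, 0 < C K M) ∧
      ∀ (A : Set ℝ), IsOpen A → A.OrdConnected →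
      ∀ (ξ : A → E → E → ℝ) (α₀ : Θ → A),
        (∀ α, Measurable (fun p : E × E => ξ α p.1 p.2)) →
        IsCentered Q π ξ α₀ → ConditionD V ξ 2 →
        ∃ σsq : Θ → ℝ, (∀ θ, 0 ≤ σsq θ) ∧ (∃ B : ℝ, ∀ θ, σsq θ ≤ B) ∧
          ∀ {Ω : Type*} [MeasurableSpace Ω] (P : Θ → Measure Ω) (X : ℕ → Ω → E)
            (μ : Θ → Measure E),
            (∀ θ, IsMarkovChain (P θ) X (Q θ) (μ θ)) → ⨆ θ, meanV V (μ θ) < ∞ →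
            (∀ θ n, Integrable (fun ω => partialSum ξ X (α₀ θ) n ω ^ 2) (P θ)) ∧
            (∀ θ, Tendsto (fun n : ℕ => (∫ ω, partialSum ξ X (α₀ θ) n ω ^ 2 ∂(P θ)) / n)
              atTop (𝓝 (σsq θ))) ∧
            ∀ m K M : ℝ, 2 < m → 0 < K → Dominated V ξ m K →
              (∀ θ, meanV V (μ θ) ≤ ENNReal.ofReal M) →
              ∀ θ, ∀ n : ℕ, 1 ≤ n →
                |σsq θ - (∫ ω, partialSum ξ X (α₀ θ) n ω ^ 2 ∂(P θ)) / n| ≤ C K M / n) := by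

  obtain ⟨C, ρ, hC⟩ := hM.exists_geometricallyErgodic_sqrt
  have hVm := hM.measurable_V
  have hV1 := hM.one_le_V
  have hfin : ∀ {μ : Θ → Measure E}, ⨆ θ, meanV V (μ θ) < ∞ → ∀ θ, meanV V (μ θ) ≤
      ENNReal.ofReal (⨆ θ, meanV V (μ θ)).toReal := fun {μ} hμ θ => by
    rw [ENNReal.ofReal_toReal hμ.ne]
    exact le_iSup (fun θ => meanV V (μ θ)) θ
  refine ⟨fun A _ _ ξ α₀ hξ hc hD Ω _ P X μ hX hμ => ?_,
    fun K M => |varianceConst C ρ (max 1 K)| * |M| + 1, fun K M => by positivity,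
    fun A _ _ ξ α₀ hξ hc hD => ⟨fun θ => asymptoticVariance (Q θ) (π θ) (ξ (α₀ θ)),
      fun θ => asymptoticVariance_nonneg _ _ _, ?_, fun {Ω} _ P X μ hX hμ => ?_⟩⟩
  · obtain ⟨m, K, hm, -, hK⟩ := hD
    have hL : (0 : ℝ) ≤ max 1 K := zero_le_one.trans (le_max_left _ _)
    have hdom : ∀ α x y, |ξ α x y| ≤ max 1 K * (V x + V y) := fun α x y => by
      simpa using hK.abs_pow_le hV1 (k := 1) hm.le α x y
    have hμV : ∀ θ, Integrable V (μ θ) := fun θ =>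
      integrable_of_meanV_lt_top hVm hV1 ((le_iSup _ θ).trans_lt hμ)
    have hbd : ∀ θ, ∀ n : ℕ, |∫ ω, partialSum ξ X (α₀ θ) n ω ∂(P θ)| ≤
        |poissonConst C ρ (max 1 K)| * |(⨆ θ, meanV V (μ θ)).toReal| := fun θ n => by
      have := hM.isMarkovKernel θ
      simp only [partialSum_eq_sum_range]
      refine ((hX θ).abs_integral_sum_le (hC θ).1 (hμV θ) (hξ _) hL (hdom _)
        (hc.integral_drift hM θ) n).trans ?_
      refine mul_le_mul (le_abs_self _) (integral_le_of_meanV_le hVm hV1 (hfin hμ θ))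
        (integral_nonneg fun x => zero_le_one.trans (hV1 x)) (abs_nonneg _)
    refine ⟨fun θ n => ?_, ⟨_, fun θ n _ => hbd θ n⟩, fun θ => ?_⟩
    · have := hM.isMarkovKernel θ
      have : partialSum ξ X (α₀ θ) n =
          fun ω => ∑ k ∈ Finset.range n, ξ (α₀ θ) (X k ω) (X (k + 1) ω) :=
        funext (partialSum_eq_sum_range ξ X (α₀ θ) n)
      rw [this]
      exact integrable_finsetSum _ fun k _ =>
        (hX θ).integrable_increment (hC θ).1 (hμV θ) (hξ _) (hdom _) k
    · refine tendsto_of_abs_sub_le_div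
        (B := |poissonConst C ρ (max 1 K)| * |(⨆ θ, meanV V (μ θ)).toReal|) fun n _ => ?_
      rw [zero_sub, abs_neg, integral_div, abs_div, Nat.abs_cast]
      gcongr
      exact hbd θ n
  · obtain ⟨m, K, hm, -, hK⟩ := hD
    exact ⟨_, fun θ => by
      have := hM.isMarkovKernel θ
      exact (SquareDominated.of_dominated hM hC hξ hc (by exact_mod_cast hm) hK
        θ).asymptoticVariance_le⟩
  · have hμV : ∀ θ, Integrable V (μ θ) := fun θ =>
      integrable_of_meanV_lt_top hVm hV1 ((le_iSup _ θ).trans_lt hμ)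
    have hbd : ∀ m K M : ℝ, 2 < m → Dominated V ξ m K →
        (∀ θ, meanV V (μ θ) ≤ ENNReal.ofReal M) → ∀ θ, ∀ n : ℕ, 1 ≤ n →
        |asymptoticVariance (Q θ) (π θ) (ξ (α₀ θ)) -
          (∫ ω, partialSum ξ X (α₀ θ) n ω ^ 2 ∂(P θ)) / n| ≤
        (|varianceConst C ρ (max 1 K)| * |M| + 1) / n := by
      intro m K M hm hK hμM θ n hn
      have := hM.isMarkovKernel θ
      have hs := SquareDominated.of_dominated hM hC hξ hc hm hK θ
      have hn' : (0 : ℝ) < n := by exact_mod_cast hn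
      have h1 := hs.abs_integral_sum_sq_sub_le (hX θ) (hμV θ) n
      have h2 : varianceConst C ρ (max 1 K) * ∫ x, V x ∂(μ θ) ≤
          |varianceConst C ρ (max 1 K)| * |M| :=
        mul_le_mul (le_abs_self _) (integral_le_of_meanV_le hVm hV1 (hμM θ))
          (integral_nonneg fun x => zero_le_one.trans (hV1 x)) (abs_nonneg _)
      simp only [partialSum_eq_sum_range]
      rw [abs_sub_comm, div_sub' hn'.ne', abs_div, abs_of_pos hn']
      gcongr
      linarith
    obtain ⟨m, K, hm, -, hK⟩ := hD
    have hm' : 2 < m := by exact_mod_cast hm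
    refine ⟨fun θ n => ?_, fun θ => ?_, fun m K M hm _ hK hμM => hbd m K M hm hK hμM⟩
    · have := hM.isMarkovKernel θ
      simp only [partialSum_eq_sum_range]
      exact ((SquareDominated.of_dominated hM hC hξ hc hm' hK θ).memLp_sum (hX θ)
        (hμV θ) n).integrable_sq
    · exact tendsto_of_abs_sub_le_div (hbd m K _ hm' hK (hfin hμ) θ)
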